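/- For a set $A \subseteq \{0,1,2,\dots\}$ let $\partial A = \{z \in A : \{z-1,z+1\} \not\subseteq A\}$, $\mathrm{vol}(A)=\sum_{z\in A} z$, $\mathrm{per}(A)=\sum_{z\in\partial A} z$, and $A^c=\{0,1,2,\dots\}\setminus A$. For an integer $n\ge 0$ define $$P(n)=\min\{\mathrm{per}(A) : A\subseteq\{0,1,2,\dots\},\ \mathrm{vol}(A)=n\},\qquad Q(n)=\min\{\mathrm{per}(A^c) : A\subseteq\{0,1,2,\dots\},\ \mathrm{vol}(A)=n\},$$ $$f(n)=\lfloor\sqrt{2n}+1/2\rfloor,\qquad g(n)=\frac{f(n)(f(n)+1)}{2}-n.$$ Then for every integer $n\ge0$, $f(n)$ is the integer nearest to $\sqrt{2n}$, and $f(n)$ and $g(n)$ are the smallest nonnegative integers satisfying $[1+2+\cdots+f(n)]-g(n)=n$; that is, they satisfy it, and whenever nonnegative integers $a,b$ satisfy $[1+2+\cdots+a]-b=n$, then $f(n)\le a$ and $g(n)\le b$. Let $E$ be the following set of 177 integers: $E=\{0, 2, 4, 7, 8, 11, 16, 17, 29, 92, 125, 154, 155, 174, 361, 390, 441, 473, 529,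 564, 601, 637, 704, 742, 743, 783, 837, 1003, 1147, 1184, 1340, 1341, 1380, 1394, 1548, 1549, 1606, 1665, 1771, 1772, 1833, 1896, 2173, 2241, 2279, 2508, 2581, 2867, 2945, 3250, 3333, 3336, 3503, 3588, 3657, 3745, 3748, 3925, 4015, 4016, 4107, 4466, 4467, 4563, 4564, 4661, 5186, 5289, 5806, 5915, 6026, 6461, 6576, 6693, 6811, 7151, 7272, 7395, 7396, 7436, 7519, 8003, 8132, 8133, 8262, 8305, 9222, 9454, 10086, 10187, 10478, 11200, 11245, 11505, 12261, 12467, 12580, 12583, 12904, 13066, 13370, 13703, 13752, 14041, 14210, 14381, 15052, 15227, 15402, 15403, 15580, 15759, 16511, 17254, 17441, 17985, 18955, 19152, 19522, 20532, 20533, 20737, 21122, 21961, 22172, 22173, 22385, 22654, 22814, 23656, 23875, 23876, 24096, 24541, 24598, 26855, 28726, 28783, 28968, 30910, 31161, 33174, 33434, 35518, 35787, 36391, 37147, 39125, 39625, 39626, 39909, 41958, 44890, 47921, 50126, 51051, 53326, 53327, 53655, 56625, 56626, 56964, 61851, 65764, 66129, 69797, 70173, 73950, 74337, 78223, 78621,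 108375, 114014, 129359, 136036, 142881, 149894\}$. For every integer $n\ge 0$ with $n\notin E$ (in particular for all $n>149894$), $$P(n)=f(n)+Q(g(n))\qquad\text{and}\qquad Q(n)=1+f(n)+P(g(n)),$$ while for every $n\in E$ at least one of these two identities fails. -/

import Mathlib

/-- The boundary of `A ⊆ {0, 1, 2, …}`: the elements of `A` whose predecessor or successor is not
in `A`. (The predecessor of `0` is `-1`, which is never in `A`.) -/
def boundary (A : Set ℕ) : Set ℕ :=
  {z | z ∈ A ∧ ¬ ((∃ y ∈ A, y + 1 = z) ∧ z + 1 ∈ A)}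

/-- The volume of a finite set. (An infinite subset of `{0, 1, 2, …}` has infinite volume, so only
finite sets have volume `n`.) -/
def vol (A : Finset ℕ) : ℕ := ∑ z ∈ A, z

/-- The perimeter of `A`: the sum of the elements of its boundary. It is used only for finite sets
and complements of finite sets, whose boundaries are finite. -/
noncomputable def per (A : Set ℕ) : ℕ := ∑ᶠ z ∈ boundary A, z

/-- `P n` is the smallest perimeter of a set of volume `n`. -/
noncomputable def P (n : ℕ) : ℕ :=
  sInf {s : ℕ | ∃ A : Finset ℕ, vol A = n ∧ per (A : Set ℕ) = s}

/-- `Q n` is the smallest perimeter of the complement in `{0, 1, 2, …}` of a set of volume `n`. -/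
noncomputable def Q (n : ℕ) : ℕ :=
  sInf {s : ℕ | ∃ A : Finset ℕ, vol A = n ∧ per ((A : Set ℕ)ᶜ) = s}

/-- `f n` is `√(2n)` rounded to the nearest integer. -/
noncomputable def f (n : ℕ) : ℕ := ⌊√(2 * (n : ℝ)) + 1 / 2⌋₊

/-- `g n = f(n)(f(n)+1)/2 - n`. Neither the division nor the subtraction loses anything: the main
statement contains `f n * (f n + 1) / 2 = n + g n`. -/
noncomputable def g (n : ℕ) : ℕ := f n * (f n + 1) / 2 - n

/-- The exceptional values of `n`. -/
def exceptions : Finset ℕ :=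
  {0, 2, 4, 7, 8, 11, 16, 17, 29, 92, 125, 154, 155, 174, 361, 390, 441, 473, 529, 564,
   601, 637, 704, 742, 743, 783, 837, 1003, 1147, 1184, 1340, 1341, 1380, 1394, 1548,
   1549, 1606, 1665, 1771, 1772, 1833, 1896, 2173, 2241, 2279, 2508, 2581, 2867, 2945,
   3250, 3333, 3336, 3503, 3588, 3657, 3745, 3748, 3925, 4015, 4016, 4107, 4466, 4467,
   4563, 4564, 4661, 5186, 5289, 5806, 5915, 6026, 6461, 6576, 6693, 6811, 7151, 7272,
   7395, 7396, 7436, 7519, 8003, 8132, 8133, 8262, 8305, 9222, 9454, 10086, 10187,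
   10478, 11200, 11245, 11505, 12261, 12467, 12580, 12583, 12904, 13066, 13370, 13703,
   13752, 14041, 14210, 14381, 15052, 15227, 15402, 15403, 15580, 15759, 16511, 17254,
   17441, 17985, 18955, 19152, 19522, 20532, 20533, 20737, 21122, 21961, 22172, 22173,
   22385, 22654, 22814, 23656, 23875, 23876, 24096, 24541, 24598, 26855, 28726, 28783,
   28968, 30910, 31161, 33174, 33434, 35518, 35787, 36391, 37147, 39125, 39625, 39626,
   39909, 41958, 44890, 47921, 50126, 51051, 53326, 53327, 53655, 56625, 56626, 56964,
   61851, 65764, 66129, 69797, 70173, 73950, 74337, 78223, 78621, 108375, 114014,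
   129359, 136036, 142881, 149894}

/-- The boundary of a finite set is finite. -/
theorem boundary_finite (A : Finset ℕ) : (boundary (A : Set ℕ)).Finite :=
  A.finite_toSet.subset fun _ hz => hz.1

/-- The boundary of the complement of a finite set is finite. -/
theorem boundary_compl_finite (A : Finset ℕ) : (boundary ((A : Set ℕ)ᶜ)).Finite := by
  refine (((A.image fun a => a + 1) ∪ A.image fun a => a - 1) ∪ {0}).finite_toSet.subset ?_
  rintro z ⟨_, hz⟩
  simp only [Finset.coe_union, Finset.coe_image, Finset.coe_singleton, Set.mem_union,
    Set.mem_image, Finset.mem_coe, Set.mem_singleton_iff]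
  by_contra h
  push Not at h
  obtain ⟨⟨h1, h2⟩, h0⟩ := h
  refine hz ⟨⟨z - 1, fun hA => ?_, by omega⟩, fun hA => ?_⟩
  · exact h1 _ (Finset.mem_coe.1 hA) (by omega)
  · exact h2 _ (Finset.mem_coe.1 hA) (by omega)

/-- The infimum defining `P n` is a minimum. -/
theorem P_isLeast (n : ℕ) :
    IsLeast {s : ℕ | ∃ A : Finset ℕ, vol A = n ∧ per (A : Set ℕ) = s} (P n) :=
  ⟨Nat.sInf_mem ⟨_, {n}, by simp [vol], rfl⟩, fun _ hs => Nat.sInf_le hs⟩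

/-- The infimum defining `Q n` is a minimum. -/
theorem Q_isLeast (n : ℕ) :
    IsLeast {s : ℕ | ∃ A : Finset ℕ, vol A = n ∧ per ((A : Set ℕ)ᶜ) = s} (Q n) :=
  ⟨Nat.sInf_mem ⟨_, {n}, by simp [vol], rfl⟩, fun _ hs => Nat.sInf_le hs⟩

/-! Let `A` have maximum `m` and volume `n`, and let `B` be the set it misses below `m`, so that `B`
has volume `m(m+1)/2 - n`. The boundary of `Aᶜ` is `m + 1` together with that of `B`. The boundary
of `A` is `m` together with that of `Bᶜ` if `m - 1 ∈ A`, and together with that of `A \ {m}`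
otherwise. Hence `P` and `Q` satisfy mutual recursions over `m` (`P_lower`, `Q_lower`, `P_le_add_Q`,
`P_le_add_P`, `Q_le_add_P`), and the identities say that `m = f n` is optimal.

Perimeters are at least `m`, so `P n` and `Q n` are at least about `√(2n)`; the linear bound
`P_le_and_Q_le` makes the choice `m = f n` admissible for `n ≥ 1152`. Raising the maximum to `f n +
k` costs `k` and adds more than `k * f n` to the missing volume, so it pays only if `P` or `Q` at `g
n` is large compared to `√(2(g n + f n))`. If `g n ≥ 1152`, both are at most about `(5/4)√(2 g n)`,
which is too small because `g n < f n`. Otherwise only finitely many `f n` are critical for each `g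
n`, and tables of `P` and `Q` below 1152, certified by the same recursions, decide them. -/

/-! ### Boundaries and perimeters -/

theorem mem_boundary {A : Set ℕ} {z : ℕ} :
    z ∈ boundary A ↔ z ∈ A ∧ ((∃ y ∈ A, y + 1 = z) → z + 1 ∉ A) := by
  simp only [boundary, Set.mem_ofPred_eq, not_and]

/-- Adding to a boundary one new point increases the perimeter by that point. -/
theorem per_eq_add {A B : Set ℕ} {m : ℕ} (h : boundary A = insert m (boundary B))
    (hm : m ∉ boundary B) (hB : (boundary B).Finite) : per A = m + per B := by
  rw [per, per, h, finsum_mem_insert (fun z : ℕ => z) hm hB]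

theorem le_per {A : Set ℕ} {z : ℕ} (hA : (boundary A).Finite) (hz : z ∈ boundary A) :
    z ≤ per A := by
  rw [per, finsum_mem_eq_finite_toFinset_sum _ hA]
  exact Finset.single_le_sum (f := fun i : ℕ => i) (fun _ _ => Nat.zero_le _)
    (hA.mem_toFinset.2 hz)

theorem le_per_of_mem {A : Finset ℕ} {z : ℕ} (hz : z ∈ A) : z ≤ per (A : Set ℕ) := by
  have hne : A.Nonempty := ⟨z, hz⟩
  refine (A.le_max' z hz).trans (le_per (boundary_finite A) (mem_boundary.2 ⟨?_, fun _ h => ?_⟩))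
  · exact A.max'_mem hne
  · have := A.le_max' _ (Finset.mem_coe.1 h)
    omega

theorem succ_le_per_compl_of_mem {A : Finset ℕ} {z : ℕ} (hz : z ∈ A) :
    z + 1 ≤ per ((A : Set ℕ)ᶜ) := by
  have hne : A.Nonempty := ⟨z, hz⟩
  have h : A.max' hne + 1 ∈ boundary ((A : Set ℕ)ᶜ) := by
    refine mem_boundary.2 ⟨fun h => ?_, ?_⟩
    · have := A.le_max' _ (Finset.mem_coe.1 h)
      omega
    · rintro ⟨y, hy, hy'⟩ -
      obtain rfl : y = A.max' hne := by omega
      exact hy (A.max'_mem hne)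
  have := A.le_max' z hz
  have := le_per (boundary_compl_finite A) h
  omega

/-! ### Complementing below the maximum -/

theorem vol_range_sdiff {B : Finset ℕ} {m : ℕ} (hB : ∀ z ∈ B, z ≤ m) :
    2 * (vol (Finset.range (m + 1) \ B) + vol B) = m * (m + 1) := by
  have hsub : B ⊆ Finset.range (m + 1) := fun z hz => by
    have := hB z hz
    simp only [Finset.mem_range]
    omega
  have h := Finset.sum_range_id_mul_two (m + 1)
  rw [vol, vol, Finset.sum_sdiff hsub, mul_comm, h, Nat.add_sub_cancel, mul_comm]

theorem per_compl_range_sdiff {B : Finset ℕ} {m : ℕ} (hB : ∀ z ∈ B, z < m) :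
    per (((Finset.range (m + 1) \ B : Finset ℕ) : Set ℕ)ᶜ) = m + 1 + per (B : Set ℕ) := by
  refine per_eq_add ?_ (fun h => ?_) (boundary_finite B)
  · ext z
    simp only [mem_boundary, Set.mem_insert_iff, Set.mem_compl_iff, Finset.mem_coe,
      Finset.mem_sdiff, Finset.mem_range, not_and, not_not]
    constructor
    · rintro ⟨h1, h2⟩
      by_cases hz : z < m + 1
      · refine Or.inr ⟨h1 hz, ?_⟩
        rintro ⟨y, hy, rfl⟩ h3
        exact h2 ⟨y, fun _ => hy, rfl⟩ fun _ => h3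
      · by_contra hcon
        push Not at hcon
        exact h2 ⟨z - 1, by omega, by omega⟩ (by omega)
    · rintro (rfl | ⟨h1, h2⟩)
      · refine ⟨by omega, ?_⟩
        rintro ⟨y, hy, hy'⟩
        obtain rfl : y = m := by omega
        exact absurd (hB _ (hy (by omega))) (by omega)
      · have hz := hB z h1
        refine ⟨fun _ => h1, ?_⟩
        rintro ⟨y, hy, rfl⟩
        exact fun h => h2 ⟨y, hy (by omega), rfl⟩ (h (by omega))
  · exact absurd (hB _ (Finset.mem_coe.1 h.1)) (by omega)

/-- Both `m - 1` and `m` lie outside `B`, so the two boundaries agree below `m`, and `m` and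
everything above it is interior to `Bᶜ`. -/
theorem per_range_sdiff {B : Finset ℕ} {m : ℕ} (hm : 1 ≤ m) (hB : ∀ z ∈ B, z + 1 < m) :
    per ((Finset.range (m + 1) \ B : Finset ℕ) : Set ℕ) = m + per ((B : Set ℕ)ᶜ) := by
  refine per_eq_add ?_ (fun h => ?_) (boundary_compl_finite B)
  · ext z
    simp only [mem_boundary, Set.mem_insert_iff, Set.mem_compl_iff, Finset.mem_coe,
      Finset.mem_sdiff, Finset.mem_range, not_and, not_not]
    constructor
    · rintro ⟨⟨h1, h2⟩, h3⟩
      by_cases hz : z = m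
      · exact Or.inl hz
      · refine Or.inr ⟨h2, ?_⟩
        rintro ⟨y, hy, rfl⟩
        exact h3 ⟨y, ⟨by omega, hy⟩, rfl⟩ (by omega)
    · rintro (rfl | ⟨h1, h2⟩)
      · exact ⟨⟨by omega, fun h => absurd (hB _ h) (by omega)⟩, by omega⟩
      · have hz : z < m + 1 := by
          by_contra hz
          have := hB _ (h2 ⟨z - 1, fun h => absurd (hB _ h) (by omega), by omega⟩)
          omega
        refine ⟨⟨hz, h1⟩, ?_⟩
        rintro ⟨y, hy, rfl⟩ _
        exact h2 ⟨y, hy.2, rfl⟩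
  · have h3 := (mem_boundary.1 h).2 ⟨m - 1, fun h => ?_, by omega⟩
    · exact h3 fun h => absurd (hB _ (Finset.mem_coe.1 h)) (by omega)
    · exact absurd (hB _ (Finset.mem_coe.1 h)) (by omega)

theorem per_insert {C : Finset ℕ} {m : ℕ} (hC : ∀ z ∈ C, z + 1 < m) :
    per ((insert m C : Finset ℕ) : Set ℕ) = m + per (C : Set ℕ) := by
  refine per_eq_add ?_ (fun h => ?_) (boundary_finite C)
  · ext z
    simp only [mem_boundary, Set.mem_insert_iff, Finset.mem_coe, Finset.mem_insert]
    constructor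
    · rintro ⟨rfl | h1, h2⟩
      · exact Or.inl rfl
      · refine Or.inr ⟨h1, ?_⟩
        rintro ⟨y, hy, rfl⟩ h3
        exact h2 ⟨y, Or.inr hy, rfl⟩ (Or.inr h3)
    · rintro (rfl | ⟨h1, h2⟩)
      · refine ⟨Or.inl rfl, fun _ => ?_⟩
        rintro (h | h)
        · omega
        · exact absurd (hC _ h) (by omega)
      · have hz := hC z h1
        refine ⟨Or.inr h1, ?_⟩
        rintro ⟨y, hy | hy, rfl⟩
        · omega
        · rintro (h | h)
          · omega
          · exact h2 ⟨y, hy, rfl⟩ h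
  · exact absurd (hC _ (Finset.mem_coe.1 h.1)) (by omega)

theorem P_zero : P 0 = 0 :=
  Nat.le_zero.1 ((P_isLeast 0).2 ⟨∅, rfl, by simp [per, boundary]⟩)

theorem Q_zero : Q 0 = 0 := by
  refine Nat.le_zero.1 ((Q_isLeast 0).2 ⟨∅, rfl, ?_⟩)
  have h : boundary ((∅ : Set ℕ)ᶜ) = {0} := by
    ext z
    simp only [mem_boundary, Set.compl_empty, Set.mem_univ, true_and, not_true, imp_false,
      Set.mem_singleton_iff, not_exists]
    refine ⟨fun h => ?_, fun h y hy => by omega⟩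
    by_contra hz
    exact h (z - 1) (by omega)
  rw [per, Finset.coe_empty, h]
  simp

/-- A set of positive volume with maximum `m`, described by the set `B` it misses below `m`. -/
theorem exists_eq_range_sdiff {A : Finset ℕ} (hA : 1 ≤ vol A) :
    ∃ m B, 1 ≤ m ∧ m ∈ A ∧ (∀ z ∈ A, z ≤ m) ∧ (∀ z, z ∈ B ↔ z < m ∧ z ∉ A) ∧
      A = Finset.range (m + 1) \ B ∧ 2 * (vol A + vol B) = m * (m + 1) := by
  have hne : A.Nonempty := by
    rw [Finset.nonempty_iff_ne_empty]
    rintro rfl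
    simp [vol] at hA
  obtain ⟨m, hm, hmax⟩ : ∃ m ∈ A, ∀ z ∈ A, z ≤ m := ⟨A.max' hne, A.max'_mem hne, A.le_max'⟩
  have hB : ∀ z, z ∈ (Finset.range m).filter (· ∉ A) ↔ z < m ∧ z ∉ A := by simp
  have hAB : A = Finset.range (m + 1) \ (Finset.range m).filter (· ∉ A) := by
    ext z
    rw [Finset.mem_sdiff, hB, Finset.mem_range]
    constructor
    · intro h
      have := hmax z h
      exact ⟨by omega, fun h' => h'.2 h⟩
    · rintro ⟨h1, h2⟩
      by_contra h3
      refine h2 ⟨lt_of_le_of_ne (by omega) ?_, h3⟩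
      rintro rfl
      exact h3 hm
  refine ⟨m, _, ?_, hm, hmax, hB, hAB, ?_⟩
  · by_contra h0
    have : vol A = 0 := Finset.sum_eq_zero fun z hz => by
      have := hmax z hz
      omega
    omega
  · nth_rewrite 1 [hAB]
    exact vol_range_sdiff fun z hz => ((hB z).1 hz).1.le

/-! ### Recursive and quadratic bounds for `P` and `Q` -/

theorem P_lower {n : ℕ} (hn : 1 ≤ n) : ∃ m, 2 * n ≤ m * (m + 1) ∧
    ((1 ≤ m ∧ m ≤ n ∧ m + P (n - m) ≤ P n) ∨
      ∃ b, m * (m + 1) = 2 * (n + b) ∧ m + Q b ≤ P n) := by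
  obtain ⟨A, rfl, hP⟩ := (P_isLeast n).1
  obtain ⟨m, B, hm, hmA, hmax, hB, hAB, hvol⟩ := exists_eq_range_sdiff hn
  refine ⟨m, by omega, ?_⟩
  rw [← hP]
  by_cases h : m - 1 ∈ A
  · refine Or.inr ⟨vol B, hvol.symm, ?_⟩
    have hB' : ∀ z ∈ B, z + 1 < m := fun z hz => by
      obtain ⟨h1, h2⟩ := (hB z).1 hz
      by_contra h3
      obtain rfl : z = m - 1 := by omega
      exact h2 h
    rw [hAB, per_range_sdiff hm hB']
    exact Nat.add_le_add_left ((Q_isLeast _).2 ⟨B, rfl, rfl⟩) _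
  · have hins := Finset.insert_erase hmA
    have hv : m + vol (A.erase m) = vol A := Finset.add_sum_erase A (fun z => z) hmA
    have hC : ∀ z ∈ A.erase m, z + 1 < m := fun z hz => by
      obtain ⟨h1, h2⟩ := Finset.mem_erase.1 hz
      have := hmax z h2
      by_contra h3
      obtain rfl : z = m - 1 := by omega
      exact h h2
    refine Or.inl ⟨hm, by omega, ?_⟩
    rw [← hins, per_insert hC, hins]
    exact Nat.add_le_add_left ((P_isLeast _).2 ⟨A.erase m, by omega, rfl⟩) _

theorem Q_lower {n : ℕ} (hn : 1 ≤ n) :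
    ∃ m b, m * (m + 1) = 2 * (n + b) ∧ m + 1 + P b ≤ Q n := by
  obtain ⟨A, rfl, hQ⟩ := (Q_isLeast n).1
  obtain ⟨m, B, hm, hmA, hmax, hB, hAB, hvol⟩ := exists_eq_range_sdiff hn
  refine ⟨m, vol B, hvol.symm, ?_⟩
  rw [← hQ, hAB, per_compl_range_sdiff fun z hz => ((hB z).1 hz).1]
  exact Nat.add_le_add_left ((P_isLeast _).2 ⟨B, rfl, rfl⟩) _

/-- The perimeter of `Bᶜ` exceeds every element of `B`, so `hb` keeps an optimal `B` below `m - 1`,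
as `per_range_sdiff` needs. -/
theorem P_le_add_Q {n m b : ℕ} (h : m * (m + 1) = 2 * (n + b)) (hb : Q b + 1 ≤ m) :
    P n ≤ m + Q b := by
  obtain ⟨B, rfl, hQ⟩ := (Q_isLeast b).1
  have hB : ∀ z ∈ B, z + 1 < m := fun z hz => by
    have := succ_le_per_compl_of_mem hz
    omega
  have hv := vol_range_sdiff (B := B) (m := m) fun z hz => by
    have := hB z hz
    omega
  refine (P_isLeast n).2 ⟨Finset.range (m + 1) \ B, by omega, ?_⟩
  rw [per_range_sdiff (by omega) hB, hQ]

theorem P_le_add_P {n m : ℕ} (h : m ≤ n) (hb : P (n - m) + 2 ≤ m) :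
    P n ≤ m + P (n - m) := by
  obtain ⟨C, hC, hP⟩ := (P_isLeast (n - m)).1
  have hC' : ∀ z ∈ C, z + 1 < m := fun z hz => by
    have := le_per_of_mem hz
    omega
  refine (P_isLeast n).2 ⟨insert m C, ?_, ?_⟩
  · rw [vol] at hC ⊢
    rw [Finset.sum_insert fun h => absurd (hC' _ h) (by omega)]
    omega
  · rw [per_insert hC', hP]

theorem Q_le_add_P {n m b : ℕ} (h : m * (m + 1) = 2 * (n + b)) (hb : P b + 1 ≤ m) :
    Q n ≤ m + 1 + P b := by
  obtain ⟨B, rfl, hP⟩ := (P_isLeast b).1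
  have hB : ∀ z ∈ B, z < m := fun z hz => by
    have := le_per_of_mem hz
    omega
  have hv := vol_range_sdiff fun z hz => (hB z hz).le
  refine (Q_isLeast n).2 ⟨Finset.range (m + 1) \ B, by omega, ?_⟩
  rw [per_compl_range_sdiff hB, hP]

/-- The maximum `m` of an optimal set is at most its perimeter, and `n ≤ 1 + ⋯ + m`. -/
theorem two_mul_le_P (n : ℕ) : 2 * n ≤ P n * (P n + 1) := by
  induction n using Nat.strong_induction_on with
  | _ n ih =>
    rcases Nat.eq_zero_or_pos n with rfl | hn
    · simp
    obtain ⟨m, hm, ⟨h1, h2, h3⟩ | ⟨b, h1, h2⟩⟩ := P_lower hn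
    · have := ih (n - m) (by omega)
      obtain ⟨k, rfl⟩ := Nat.exists_eq_add_of_le h2
      rw [Nat.add_sub_cancel_left] at *
      nlinarith
    · nlinarith

theorem two_mul_le_Q {n : ℕ} (hn : 1 ≤ n) : 2 * n ≤ Q n * (Q n - 1) := by
  obtain ⟨m, b, h1, h2⟩ := Q_lower hn
  obtain ⟨k, hk⟩ := Nat.exists_eq_add_of_le (show m + 1 ≤ Q n by omega)
  rw [hk, show m + 1 + k - 1 = m + k by omega]
  nlinarith

/-! ### Certified tables of small values -/

/-- The entry `n` of a table that lists 48 values in each number, as digits in base 100. -/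
def entry (T : List ℕ) (n : ℕ) : ℕ := T.getD (n / 48) 0 / 100 ^ (n % 48) % 100

/-- The values of `P` below 1152. -/
def tableP : List ℕ :=
  [ 171609111312151413161608101211141312140709111013121106081009111005070908080406070603050402020100,
    192422221315171619181720201918232112141615181716191918172211131514171615181817161012141316151417,
    222725252423291618201922212023232221252424232215171918212019222221202523232214161817201918212120,
    291921232225242326262524292727262529302818202221242322252524232826262524292817192120232221242423,
    292834333131302921232524272625282827263129292827333230302920222423262524272726253028282726323129,
    323130363533333231353723252726292827303029283331313029353432323130342224262528272629292827323030,
    383735353433373938362527292831302932323130353333323137363434333236383724262827302928313130293432,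
    414038383727293130333231343433323735353433393836363534384039373726283029323130333332313634343332,
    353433363635343937373635414038383736404241393938372830323134333235353433383636353439393737363539,
    424040393842434341414039464330323433363534373736354038383736424139393837414342404039384529313332,
    343635383736393938374240403938444341414039434544424241404744463133353437363538383736413939383743,
    424145474644444342494647474533353736393837404039384341414039454442424140444645434342414845474632,
    424241404543434241474644444342464847454544434947494846463436383740393841414039444242414046454343,
    504848474636384039424140434342414644444342484745454443474948464645444948504947474635373938414039,
    495150484847465350525149494847543739414043424144444342474545444349484646454448504947474645524951,
    474645515048484746505251494948475451535250504948545338404241444342454544434846464544504947474645,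
    454447474645504848474652514949484751535250504948555254535151504954565339414342454443464645444947,
    575641434544474645484847465149494847535250504948525453515150495653555452525150585754564042444346,
    535260595658575542444645484746494948475250504948545351515049535554525251505754565553535251595855,
    585755555453616057595856564345474649484750504948535151504955545252515054565553535251585557565454,
    536057595856565554626158605957575644464847504948515150495452525150565553535251555756545453525956,
    565554615860595757565563625961605858575645474948515049525251505553535251575654545352565857555554,
    575756556259616058585756646360626159595857644648504952515053535251565454535258575555545357595856,
    585857566260626159595857656461636260605958656647495150535251545453525755555453595856565554586059 ]

/-- The values of `Q` below 1152. -/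
def tableQ : List ℕ :=
  [ 181710111212141513161709101111131412150809101012131107080909111206070808100506070704050603040200,
    192323231415161618191720212018222213141515171816192019172112131414161715181918161112131315161417,
    222626272523281718191921222023242321252526242216171818202119222322202424252315161717192018212221,
    312021222224252326272624282829272529312919202121232422252625232727282624292818192020222321242524,
    302833343233312922232424262725282928263030312927323331323021222323252624272827252929302826313230,
    343230353634353331363724252626282927303130283232333129343533343230352324252527282629302927313132,
    373836373533383940372627282830312932333230343435333136373536343237383925262727293028313231293333,
    414239403828293030323331343534323636373533383837383634394041383927282929313230333433313535363432,
    343533363736343838393735404139403836414243404139372930313133343235363533373738363439403839373540,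
    434142403843434542434139464431323333353634373837353939403836414240413937424342414240384530313232,
    343535373836394039374141424038434442434139444546434442404745463233343436373538393836404041393742,
    434146474845464442494747494634353636383937404140384242434139444543444240454647444543414846474633,
    424342404444454341464745464442474849464745435048495047483536373739403841424139434344424045464445,
    524950484637383939414240434443414545464442474846474543484950474846444949505148494736373838404139,
    505152495048465351525350514947553839404042434144454442464647454348494748464449505148494745525051,
    494745505149504846515253505149475452535451525048555339404141434442454645434747484644495048494745,
    464447484745494950484651525051494752535451525048555354555253514954575440414242444543464746444848,
    575842434444464745484948465050514947525351525048535454525351495654555653545250585855564142434345,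
    545260605758595643444545474846495049475151525048535452535149545556535452505755565754555351595956,
    585956575553616158596057584445464648494750515048525253514954555354525055565754555351585657585556,
    536058595957585654626259606158595745464747495048515251495353545250555654555351565758555654525957,
    585654615960615859575563636061625960585646474848505149525352505454555351565755565452575859565755,
    585957556260616259605856646461626360615957644748494951525053545351555556545257585657555358596057,
    596058566261626360615957656562636461626058656648495050525351545554525656575553585957585654596061 ]

/-- The table entry for `P n`. -/
def smallP (n : ℕ) : ℕ := entry tableP n

/-- The table entry for `Q n`. -/
def smallQ (n : ℕ) : ℕ := entry tableQ n

/-- `p m` holds for all `m < k` with `2 * n ≤ m * (m + 1)`. -/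
def allBelow (n : ℕ) (p : ℕ → Bool) (k : ℕ) : Bool :=
  -- The recursion descends from `k - 1` and stops at the first `m` with `m * (m + 1) < 2 * n`.
  Nat.rec true (fun m ih => Nat.blt (m * (m + 1)) (2 * n) || (p m && ih)) k

/-- `p m` holds for some `m < k` with `2 * n ≤ m * (m + 1)`. -/
def anyBelow (n : ℕ) (p : ℕ → Bool) (k : ℕ) : Bool :=
  Nat.rec false (fun m ih => Nat.ble (2 * n) (m * (m + 1)) && (p m || ih)) k

theorem of_allBelow {n : ℕ} {p : ℕ → Bool} {k m : ℕ} (h : allBelow n p k = true) (hm : m < k)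
    (hn : 2 * n ≤ m * (m + 1)) : p m = true := by
  induction k with
  | zero => omega
  | succ k ih =>
    change (Nat.blt (k * (k + 1)) (2 * n) || (p k && allBelow n p k)) = true at h
    rw [Bool.or_eq_true, Bool.and_eq_true, Nat.blt_eq] at h
    have hmk : m * (m + 1) ≤ k * (k + 1) := Nat.mul_le_mul (by omega) (by omega)
    obtain h | ⟨h1, h2⟩ := h
    · omega
    · rcases Nat.lt_succ_iff_lt_or_eq.1 hm with hm | rfl
      · exact ih h2 hm
      · exact h1

theorem of_anyBelow {n : ℕ} {p : ℕ → Bool} {k : ℕ} (h : anyBelow n p k = true) :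
    ∃ m, 2 * n ≤ m * (m + 1) ∧ p m = true := by
  induction k with
  | zero => cases h
  | succ k ih =>
    change (Nat.ble (2 * n) (k * (k + 1)) && (p k || anyBelow n p k)) = true at h
    rw [Bool.and_eq_true, Bool.or_eq_true, Nat.ble_eq] at h
    obtain ⟨h1, h2 | h2⟩ := h
    · exact ⟨k, h1, h2⟩
    · exact ih h2

/-- For `2 * n ≤ m * (m + 1)`, the table entry for `P n` is at most the lower bound that sets with
maximum `m` give. -/
def lowerP (n m : ℕ) : Bool :=
  (Nat.blt n m || Nat.ble (smallP n) (m + smallP (n - m))) &&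
    -- A set beating the table and missing volume `b` has `Q b ≤ smallP n - m - 1`, which
    -- contradicts `2b ≤ Q b (Q b - 1)` when `b` is large. Otherwise `m(m+1) < 4n` gives `b < n`, so
    -- the table entry at `b` is already known.
    (Nat.blt ((smallP n - m - 1) * (smallP n - m - 2) + 2 * n) (m * (m + 1)) ||
      (Nat.blt (m * (m + 1)) (4 * n) &&
        Nat.ble (smallP n) (m + smallQ (m * (m + 1) / 2 - n))))

/-- For `2 * n ≤ m * (m + 1)`, the table entry for `Q n` is at most the lower bound that sets with
maximum `m` give. -/
def lowerQ (n m : ℕ) : Bool :=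
  Nat.blt ((smallQ n - m - 1 - 1) * (smallQ n - m - 1) + 2 * n) (m * (m + 1)) ||
    (Nat.blt (m * (m + 1)) (4 * n) &&
      Nat.ble (smallQ n) (m + 1 + smallP (m * (m + 1) / 2 - n)))

/-- Some set with maximum `m` shows that `P n` is at most its table entry. -/
def upperP (n m : ℕ) : Bool :=
  (Nat.blt (m * (m + 1)) (4 * n) && Nat.blt (smallQ (m * (m + 1) / 2 - n)) m &&
      Nat.ble (m + smallQ (m * (m + 1) / 2 - n)) (smallP n)) ||
    (Nat.ble 1 m && Nat.ble m n && Nat.ble (smallP (n - m) + 2) m &&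
      Nat.ble (m + smallP (n - m)) (smallP n))

/-- Some set with maximum `m` shows that `Q n` is at most its table entry. -/
def upperQ (n m : ℕ) : Bool :=
  Nat.blt (m * (m + 1)) (4 * n) && Nat.blt (smallP (m * (m + 1) / 2 - n)) m &&
    Nat.ble (m + 1 + smallP (m * (m + 1) / 2 - n)) (smallQ n)

/-- The ranges of `m` suffice because a set beating the entry has its maximum below that entry. The
value `n = 0` is separate, since its sets need not have a positive maximum. -/
theorem table_check : ((List.range 1152).all fun n => Nat.beq n 0 ||
    (allBelow n (lowerP n) (smallP n) && allBelow n (lowerQ n) (smallQ n) &&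
      anyBelow n (upperP n) (smallP n + 1) && anyBelow n (upperQ n) (smallQ n))) = true := by
  decide +kernel

theorem table_correct (n : ℕ) (hn : n < 1152) : P n = smallP n ∧ Q n = smallQ n := by
  induction n using Nat.strong_induction_on with
  | _ n ih =>
  have hP : ∀ k < n, P k = smallP k := fun k hk => (ih k hk (by omega)).1
  have hQ : ∀ k < n, Q k = smallQ k := fun k hk => (ih k hk (by omega)).2
  rcases Nat.eq_zero_or_pos n with rfl | h0
  · exact ⟨by rw [P_zero]; decide +kernel, by rw [Q_zero]; decide +kernel⟩
  have hc := List.all_eq_true.1 table_check n (List.mem_range.2 hn)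
  rw [Bool.or_eq_true, Nat.beq_eq, or_iff_right h0.ne', Bool.and_eq_true, Bool.and_eq_true,
    Bool.and_eq_true] at hc
  obtain ⟨⟨⟨hlP, hlQ⟩, huP⟩, huQ⟩ := hc
  refine ⟨le_antisymm ?_ ?_, le_antisymm ?_ ?_⟩
  · obtain ⟨m, hm, h⟩ := of_anyBelow huP
    simp only [upperP, Bool.or_eq_true, Bool.and_eq_true, Nat.blt_eq, Nat.ble_eq] at h
    obtain ⟨⟨h1, h2⟩, h3⟩ | ⟨⟨⟨h1, h2⟩, h3⟩, h4⟩ := h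
    · have h2m := Nat.even_mul_succ_self m
      rw [← hQ _ (by omega)] at h2 h3
      refine (P_le_add_Q (b := m * (m + 1) / 2 - n) ?_ h2).trans h3
      have := h2m.two_dvd
      omega
    · rw [← hP _ (by omega)] at h3 h4
      exact (P_le_add_P h2 h3).trans h4
  · obtain ⟨m, hm, h⟩ := P_lower h0
    by_contra! hlt
    have hc := of_allBelow hlP (m := m) (by
      obtain ⟨_, _, _⟩ | ⟨_, _, _⟩ := h <;> omega) hm
    simp only [lowerP, Bool.or_eq_true, Bool.and_eq_true, Nat.blt_eq, Nat.ble_eq] at hc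
    obtain ⟨hc1, hc2⟩ := hc
    obtain ⟨h1, h2, h3⟩ | ⟨b, h1, h2⟩ := h
    · rw [hP _ (by omega)] at h3
      omega
    · obtain hc2 | ⟨hc2, hc3⟩ := hc2
      · rcases Nat.eq_zero_or_pos b with rfl | hb
        · omega
        have h3 := two_mul_le_Q hb
        have h4 : Q b * (Q b - 1) ≤ (smallP n - m - 1) * (smallP n - m - 2) :=
          Nat.mul_le_mul (by omega) (by omega)
        omega
      · rw [show m * (m + 1) / 2 - n = b by omega, ← hQ b (by omega)] at hc3
        omega
  · obtain ⟨m, hm, h⟩ := of_anyBelow huQ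
    simp only [upperQ, Bool.and_eq_true, Nat.blt_eq, Nat.ble_eq] at h
    obtain ⟨⟨h1, h2⟩, h3⟩ := h
    have h2m := (Nat.even_mul_succ_self m).two_dvd
    rw [← hP _ (by omega)] at h2 h3
    exact (Q_le_add_P (b := m * (m + 1) / 2 - n) (by omega) h2).trans h3
  · obtain ⟨m, b, h1, h2⟩ := Q_lower h0
    by_contra! hlt
    have hc := of_allBelow hlQ (m := m) (by omega) (by omega)
    simp only [lowerQ, Bool.or_eq_true, Bool.and_eq_true, Nat.blt_eq, Nat.ble_eq] at hc
    obtain hc2 | ⟨hc2, hc3⟩ := hc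
    · have h3 := two_mul_le_P b
      have h4 : P b * (P b + 1) ≤ (smallQ n - m - 1 - 1) * (smallQ n - m - 1) :=
        Nat.mul_le_mul (by omega) (by omega)
      omega
    · rw [show m * (m + 1) / 2 - n = b by omega, ← hP b (by omega)] at hc3
      omega

/-! ### The functions `f` and `g` -/

/-- These are `(f - 1/2)² ≤ 2n < (f + 1/2)²` read in integers. -/
theorem f_spec (n : ℕ) : 2 * n ≤ f n * (f n + 1) ∧ (1 ≤ n → f n * (f n - 1) < 2 * n) := by
  have h0 : 0 ≤ √(2 * (n : ℝ)) := Real.sqrt_nonneg _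
  have hs : √(2 * (n : ℝ)) ^ 2 = 2 * n := Real.sq_sqrt (by positivity)
  have h1 : ((f n : ℕ) : ℝ) ≤ √(2 * (n : ℝ)) + 1 / 2 := Nat.floor_le (by positivity)
  have h2 : √(2 * (n : ℝ)) + 1 / 2 < (f n : ℝ) + 1 := Nat.lt_floor_add_one _
  constructor
  · have h3 : 2 * (n : ℝ) < (f n : ℝ) * (f n + 1) + 1 := by nlinarith
    have h4 : 2 * n < f n * (f n + 1) + 1 := by exact_mod_cast h3
    omega
  · intro hn
    rcases Nat.eq_zero_or_pos (f n) with h | h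
    · rw [h]
      omega
    obtain ⟨k, hk⟩ := Nat.exists_eq_add_of_le' h
    rw [hk] at h1 ⊢
    push_cast at h1
    have h3 : (k : ℝ) * (k + 1) < 2 * n := by
      have hk0 : (0 : ℝ) ≤ k := Nat.cast_nonneg k
      nlinarith
    have h4 : k * (k + 1) < 2 * n := by exact_mod_cast h3
    rw [Nat.add_sub_cancel, mul_comm]
    exact h4

theorem f_le {n a : ℕ} (h : 2 * n ≤ a * (a + 1)) : f n ≤ a := by
  rcases Nat.eq_zero_or_pos n with rfl | hn
  · have : f 0 = 0 := by
      rw [f, Nat.floor_eq_zero]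
      norm_num
    omega
  by_contra! hlt
  have h1 := (f_spec n).2 hn
  have h2 : (a + 1) * a ≤ f n * (f n - 1) := Nat.mul_le_mul (by omega) (by omega)
  rw [mul_comm] at h2
  omega

theorem f_eq {n a : ℕ} (h : 2 * n ≤ a * (a + 1)) (h' : a * (a - 1) < 2 * n) : f n = a := by
  refine le_antisymm (f_le h) ?_
  by_contra! hlt
  have h1 := (f_spec n).1
  have h2 : f n * (f n + 1) ≤ (a - 1) * a := Nat.mul_le_mul (by omega) (by omega)
  rw [mul_comm (a - 1)] at h2
  omega

theorem f_mul_succ (n : ℕ) : f n * (f n + 1) = 2 * (n + g n) := by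
  have h1 := (f_spec n).1
  have h2 := (Nat.even_mul_succ_self (f n)).two_dvd
  rw [g]
  omega

theorem g_lt_f {n : ℕ} (hn : 1 ≤ n) : g n < f n := by
  have h1 := f_mul_succ n
  have h2 := (f_spec n).2 hn
  rcases Nat.eq_zero_or_pos (f n) with h | h
  · rw [h] at h1
    omega
  obtain ⟨k, hk⟩ := Nat.exists_eq_add_of_le' h
  rw [hk] at h1 h2 ⊢
  rw [Nat.add_sub_cancel] at h2
  nlinarith

theorem f_eq_round (n : ℕ) : (f n : ℤ) = round √(2 * (n : ℝ)) := by
  rw [round_eq, f]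
  exact Int.natCast_floor_eq_floor (by positivity)

theorem two_mul_sum_Icc (a : ℕ) : 2 * ∑ i ∈ Finset.Icc 1 a, (i : ℤ) = a * (a + 1) := by
  induction a with
  | zero => simp
  | succ a ih =>
    rw [Finset.sum_Icc_succ_top (by omega), mul_add, ih]
    push_cast
    ring

/-! ### The identities for large `n` -/

theorem le_f {n : ℕ} (hn : 1152 ≤ n) : 48 ≤ f n := by
  have h := (f_spec n).1
  by_contra! hlt
  have : f n * (f n + 1) ≤ 47 * 48 := Nat.mul_le_mul (by omega) (by omega)
  omega

theorem table_le : ((List.range 1152).all fun n =>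
    Nat.ble (4 * smallP n) (n + 32) && Nat.ble (4 * smallQ n) (n + 32)) = true := by
  decide +kernel

/-- This crude bound serves to make `P (g n)` and `Q (g n)` smaller than `f n`. By induction `P n`
and `Q n` are at most about `5 f n / 4`, far below `n / 4`; the 32 absorbs the small values. -/
theorem P_le_and_Q_le (n : ℕ) : 4 * P n ≤ n + 32 ∧ 4 * Q n ≤ n + 32 := by
  induction n using Nat.strong_induction_on with
  | _ n ih =>
  rcases lt_or_ge n 1152 with hn | hn
  · have h := List.all_eq_true.1 table_le n (List.mem_range.2 hn)
    rw [Bool.and_eq_true, Nat.ble_eq, Nat.ble_eq] at h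
    rwa [(table_correct n hn).1, (table_correct n hn).2]
  have hf := le_f hn
  have hg := g_lt_f (n := n) (by omega)
  have hfg := f_mul_succ n
  have hgn : 5 * f n + 4 ≤ n := by nlinarith
  obtain ⟨hP, hQ⟩ := ih (g n) (by omega)
  have h1 := P_le_add_Q hfg (by omega)
  have h2 := Q_le_add_P hfg (by omega)
  omega

/-- The bounds that the identities give when `n` is large. -/
theorem P_le_and_Q_le_f {n : ℕ} (hn : 1152 ≤ n) :
    4 * P n ≤ 5 * f n + 31 ∧ 4 * Q n ≤ 5 * f n + 35 := by
  have hf := le_f hn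
  have hg := g_lt_f (n := n) (by omega)
  have hfg := f_mul_succ n
  obtain ⟨hP, hQ⟩ := P_le_and_Q_le (g n)
  have h1 := P_le_add_Q hfg (by omega)
  have h2 := Q_le_add_P hfg (by omega)
  omega

/-- Here `h1` rules out the maximum `f n + 1`, and `h2` rules out `f n + k` with `k ≥ 2`, where the
missing volume is at least `g n + 2 f n + 3`. -/
theorem P_eq_add_Q {n : ℕ} (hn : 1152 ≤ n) (h1 : Q (g n) ≤ 1 + Q (g n + f n + 1))
    (h2 : (Q (g n) - 3) * (Q (g n) - 4) < 2 * (g n + 2 * f n + 3)) : P n = f n + Q (g n) := by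
  have hf := le_f hn
  have hg := g_lt_f (n := n) (by omega)
  have hfg := f_mul_succ n
  have hQ := (P_le_and_Q_le (g n)).2
  refine le_antisymm (P_le_add_Q hfg (by omega)) ?_
  obtain ⟨m, hm, h⟩ := P_lower (n := n) (by omega)
  by_contra! hlt
  obtain ⟨k, rfl⟩ := Nat.exists_eq_add_of_le (f_le hm)
  obtain ⟨-, h4, h5⟩ | ⟨b, h4, h5⟩ := h
  -- An isolated maximum leaves volume of order `(f n)² / 2`, whose perimeter cannot be as small as
  -- `f n / 2`.
  · have h6 := two_mul_le_P (n - (f n + k))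
    have h7 : P (n - (f n + k)) * (P (n - (f n + k)) + 1) ≤ f n * f n / 4 := by
      have : 2 * P (n - (f n + k)) + 2 ≤ f n := by omega
      rw [Nat.le_div_iff_mul_le (by norm_num)]
      nlinarith
    have h8 : 48 * f n ≤ f n * f n := Nat.mul_le_mul_right _ hf
    rw [mul_add, mul_one] at hfg
    omega
  · match k with
    | 0 =>
      obtain rfl : b = g n := by
        rw [add_zero] at h4
        omega
      omega
    | 1 =>
      obtain rfl : b = g n + f n + 1 := by nlinarith
      omega
    | k + 2 =>
      have hb : g n + 2 * f n + 3 ≤ b := by nlinarith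
      have h6 := two_mul_le_Q (n := b) (by omega)
      -- A better set with `k ≥ 2` satisfies `Q b < Q (g n) - k`, hence `Q b ≤ Q (g n) - 3`.
      have h7 : Q b * (Q b - 1) ≤ (Q (g n) - 3) * (Q (g n) - 4) :=
        Nat.mul_le_mul (by omega) (by omega)
      omega

theorem Q_eq_add_P {n : ℕ} (hn : 1152 ≤ n) (h1 : P (g n) ≤ 1 + P (g n + f n + 1))
    (h2 : (P (g n) - 3) * (P (g n) - 2) < 2 * (g n + 2 * f n + 3)) :
    Q n = 1 + f n + P (g n) := by
  have hf := le_f hn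
  have hg := g_lt_f (n := n) (by omega)
  have hfg := f_mul_succ n
  have hP := (P_le_and_Q_le (g n)).1
  have hU := Q_le_add_P hfg (by omega)
  refine le_antisymm (by omega) ?_
  obtain ⟨m, b, h4, h5⟩ := Q_lower (n := n) (by omega)
  by_contra! hlt
  obtain ⟨k, rfl⟩ := Nat.exists_eq_add_of_le (f_le (n := n) (a := m) (by omega))
  match k with
  | 0 =>
    obtain rfl : b = g n := by
      rw [add_zero] at h4
      omega
    omega
  | 1 =>
    obtain rfl : b = g n + f n + 1 := by nlinarith
    omega
  | k + 2 =>
    have hb : g n + 2 * f n + 3 ≤ b := by nlinarith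
    have h6 := two_mul_le_P b
    have h7 : P b * (P b + 1) ≤ (P (g n) - 3) * (P (g n) - 2) :=
      Nat.mul_le_mul (by omega) (by omega)
    omega

/-- If `P (g n)` and `Q (g n)` are small compared to `f n`, both identities hold. -/
theorem identities_of_lt {n : ℕ} (hn : 1152 ≤ n)
    (hQ : (Q (g n) - 2) * (Q (g n) - 3) < 2 * (g n + f n + 1))
    (hP : (P (g n) - 2) * (P (g n) - 1) < 2 * (g n + f n + 1)) :
    P n = f n + Q (g n) ∧ Q n = 1 + f n + P (g n) := by
  constructor
  · refine P_eq_add_Q hn ?_ ?_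
    · by_contra! hlt
      have h1 := two_mul_le_Q (n := g n + f n + 1) (by omega)
      have h2 : Q (g n + f n + 1) * (Q (g n + f n + 1) - 1) ≤ (Q (g n) - 2) * (Q (g n) - 3) :=
        Nat.mul_le_mul (by omega) (by omega)
      omega
    · have h2 : (Q (g n) - 3) * (Q (g n) - 4) ≤ (Q (g n) - 2) * (Q (g n) - 3) :=
        Nat.mul_le_mul (by omega) (by omega)
      omega
  · refine Q_eq_add_P hn ?_ ?_
    · by_contra! hlt
      have h1 := two_mul_le_P (g n + f n + 1)
      have h2 : P (g n + f n + 1) * (P (g n + f n + 1) + 1) ≤ (P (g n) - 2) * (P (g n) - 1) :=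
        Nat.mul_le_mul (by omega) (by omega)
      omega
    · have h2 : (P (g n) - 3) * (P (g n) - 2) ≤ (P (g n) - 2) * (P (g n) - 1) :=
        Nat.mul_le_mul (by omega) (by omega)
      omega

/-- The squares of `P (g n)` and `Q (g n)` are about `(25/16) * 2 g n` at most, while `2 (g n + f n
+ 1) > 4 g n`; the margin is `25/16 < 2`. -/
theorem identities_of_le_g {n : ℕ} (hn : 1152 ≤ g n) (h0 : 1 ≤ n) :
    P n = f n + Q (g n) ∧ Q n = 1 + f n + P (g n) := by
  have hg := g_lt_f h0
  have hfg := f_mul_succ n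
  have hn' : 1152 ≤ n := by nlinarith
  obtain ⟨hP, hQ⟩ := P_le_and_Q_le_f hn
  have hf := le_f hn
  have h1 := (f_spec (g n)).2 (by omega)
  obtain ⟨k, hk⟩ := Nat.exists_eq_add_of_le hf
  rw [hk, show 48 + k - 1 = 47 + k by omega] at h1
  rw [hk] at hP hQ
  refine identities_of_lt hn' ?_ ?_
  · have h2 : (4 * (Q (g n) - 2)) * (4 * (Q (g n) - 3)) ≤ (5 * k + 267) * (5 * k + 263) :=
      Nat.mul_le_mul (by omega) (by omega)
    nlinarith
  · have h2 : (4 * (P (g n) - 2)) * (4 * (P (g n) - 1)) ≤ (5 * k + 263) * (5 * k + 267) :=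
      Nat.mul_le_mul (by omega) (by omega)
    nlinarith

/-! ### Finite checks -/

/-- Both identities, read off the tables, for `n < 1152` with `f n = a` and `g n = b`. -/
def tableIdentities (n a b : ℕ) : Bool :=
  Nat.beq (smallP n) (a + smallQ b) && Nat.beq (smallQ n) (1 + a + smallP b)

theorem small_check : ((List.range 49).all fun a => (List.range a).all fun b =>
    Nat.ble 1152 (a * (a + 1) / 2 - b) || (tableIdentities (a * (a + 1) / 2 - b) a b ||
      decide (a * (a + 1) / 2 - b ∈ exceptions))) = true := by
  decide +kernel

/-- The range of `a` for which `identities_of_lt` may fail when `f n = a` and `g n = b`. -/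
def criticalRange (b : ℕ) : List ℕ :=
  -- The range starts at `b + 1` because `g n < f n`, and ends where both hypotheses of
  -- `identities_of_lt` become true.
  List.range' (b + 1) (max ((smallQ b - 2) * (smallQ b - 3))
    ((smallP b - 2) * (smallP b - 1)) / 2 - b - (b + 1))

/-- Sets with maximum `a + 1` are not better than those with maximum `a`, by the tables. -/
def firstStep (a b : ℕ) : Bool :=
  Nat.blt (b + a + 1) 1152 && Nat.ble (smallQ b) (1 + smallQ (b + a + 1)) &&
    Nat.ble (smallP b) (1 + smallP (b + a + 1))

/-- Sets with maximum at least `a + 2` are not better than those with maximum `a`. -/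
def laterSteps (a b : ℕ) : Bool :=
  Nat.blt ((smallQ b - 3) * (smallQ b - 4)) (2 * (b + 2 * a + 3)) &&
    Nat.blt ((smallP b - 3) * (smallP b - 2)) (2 * (b + 2 * a + 3))

/-- `laterSteps` is required even at exceptions: from 1152 on, only the maximum `f n + 1` can break
an identity. -/
theorem large_check : ((List.range 1152).all fun b => (criticalRange b).all fun a =>
    Nat.blt (a * (a + 1) / 2 - b) 1152 || (laterSteps a b &&
      (firstStep a b || decide (a * (a + 1) / 2 - b ∈ exceptions)))) = true := by
  decide +kernel

/-- `f n = a`, and sets with maximum `a + 1` are better than those with maximum `a`. -/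
def betterStep (n a : ℕ) : Bool :=
  Nat.blt (a * (a - 1)) (2 * n) && Nat.blt (a * (a + 1) / 2 - n + a + 1) 1152 &&
    -- The first comparison is the admissibility condition of `P_le_add_Q` for the maximum `a + 1`.
    ((Nat.ble (smallQ (a * (a + 1) / 2 - n + a + 1)) a &&
        Nat.blt (1 + smallQ (a * (a + 1) / 2 - n + a + 1)) (smallQ (a * (a + 1) / 2 - n))) ||
      (Nat.ble (smallP (a * (a + 1) / 2 - n + a + 1)) a &&
        Nat.blt (1 + smallP (a * (a + 1) / 2 - n + a + 1)) (smallP (a * (a + 1) / 2 - n))))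

/-- `f n = a`, and one of the identities does not hold, by the tables. -/
def tableFailure (n a : ℕ) : Bool :=
  Nat.blt (a * (a - 1)) (2 * n) && !tableIdentities n a (a * (a + 1) / 2 - n)

theorem small_exceptions_check :
    ∀ n ∈ exceptions, (Nat.ble 1152 n || (Nat.beq n 0 || anyBelow n (tableFailure n) 49)) =
      true := by
  decide +kernel

/-- The largest exception 149894 has `f n = 548`, whence the search bound 549. -/
theorem large_exceptions_check :
    ∀ n ∈ exceptions, (Nat.blt n 1152 || anyBelow n (betterStep n) 549) = true := by
  decide +kernel

/-! ### The identities hold exactly off the exceptional set -/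

theorem tableIdentities_iff {n a b : ℕ} (hn : n < 1152) (hb : b < 1152) :
    tableIdentities n a b = true ↔ (P n = a + Q b ∧ Q n = 1 + a + P b) := by
  rw [tableIdentities, Bool.and_eq_true, Nat.beq_eq, Nat.beq_eq, (table_correct n hn).1,
    (table_correct n hn).2, (table_correct b hb).1, (table_correct b hb).2]

theorem identities_of_not_mem_of_lt {n : ℕ} (hn : n < 1152) (hE : n ∉ exceptions) :
    P n = f n + Q (g n) ∧ Q n = 1 + f n + P (g n) := by
  have h0 : 1 ≤ n := by
    by_contra! h0
    obtain rfl : n = 0 := by omega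
    exact hE (by decide +kernel)
  have hg := g_lt_f h0
  have hfg := f_mul_succ n
  have hf : f n < 49 := by
    by_contra! hlt
    have h1 := (f_spec n).2 h0
    have h2 : 49 * 48 ≤ f n * (f n - 1) := Nat.mul_le_mul (by omega) (by omega)
    omega
  have h := List.all_eq_true.1 (List.all_eq_true.1 small_check _ (List.mem_range.2 hf)) _
    (List.mem_range.2 hg)
  rwa [show f n * (f n + 1) / 2 - g n = n by omega, Bool.or_eq_true, Nat.ble_eq,
    or_iff_right (by omega), Bool.or_eq_true, decide_eq_true_iff, or_iff_left hE,
    tableIdentities_iff hn (by omega)] at h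

set_option maxRecDepth 10000 in
theorem not_identities_of_mem_of_lt {n : ℕ} (hn : n < 1152) (hE : n ∈ exceptions) :
    ¬ (P n = f n + Q (g n) ∧ Q n = 1 + f n + P (g n)) := by
  have h := small_exceptions_check n hE
  rw [Bool.or_eq_true, Nat.ble_eq, or_iff_right (by omega), Bool.or_eq_true, Nat.beq_eq] at h
  obtain rfl | h := h
  · rw [Q_zero]
    omega
  obtain ⟨a, ha, h⟩ := of_anyBelow h
  rw [tableFailure, Bool.and_eq_true, Nat.blt_eq, Bool.not_eq_true'] at h
  obtain ⟨h1, h2⟩ := h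
  obtain rfl := f_eq ha h1
  have hfg := f_mul_succ n
  have hg := g_lt_f (n := n) (by omega)
  have hf : f n < 49 := by
    by_contra! hlt
    have h2 : 49 * 48 ≤ f n * (f n - 1) := Nat.mul_le_mul (by omega) (by omega)
    omega
  rw [show f n * (f n + 1) / 2 - n = g n by omega, Bool.eq_false_iff, ne_eq,
    tableIdentities_iff hn (by omega)] at h2
  exact h2

theorem identities_of_not_mem {n : ℕ} (hn : 1152 ≤ n) (hE : n ∉ exceptions) :
    P n = f n + Q (g n) ∧ Q n = 1 + f n + P (g n) := by
  have hg := g_lt_f (n := n) (by omega)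
  have hfg := f_mul_succ n
  rcases le_or_gt 1152 (g n) with hgn | hgn
  · exact identities_of_le_g hgn (by omega)
  have hPg := (table_correct (g n) hgn).1
  have hQg := (table_correct (g n) hgn).2
  by_cases hc : (Q (g n) - 2) * (Q (g n) - 3) < 2 * (g n + f n + 1) ∧
      (P (g n) - 2) * (P (g n) - 1) < 2 * (g n + f n + 1)
  · exact identities_of_lt hn hc.1 hc.2
  have hmem : f n ∈ criticalRange (g n) := by
    rw [criticalRange, List.mem_range'_1, ← hPg, ← hQg]
    omega
  have h := List.all_eq_true.1 (List.all_eq_true.1 large_check _ (List.mem_range.2 hgn)) _ hmem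
  rw [show f n * (f n + 1) / 2 - g n = n by omega, Bool.or_eq_true, Nat.blt_eq,
    or_iff_right (by omega), Bool.and_eq_true, Bool.or_eq_true, decide_eq_true_iff,
    or_iff_left hE] at h
  simp only [laterSteps, firstStep, Bool.and_eq_true, Nat.blt_eq, Nat.ble_eq] at h
  obtain ⟨⟨h1, h2⟩, ⟨h3, h4⟩, h5⟩ := h
  rw [← hQg, ← (table_correct _ h3).2] at h4
  rw [← hPg, ← (table_correct _ h3).1] at h5
  rw [← hQg] at h1
  rw [← hPg] at h2
  exact ⟨P_eq_add_Q hn h4 h1, Q_eq_add_P hn h5 h2⟩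

set_option maxRecDepth 10000 in
-- A set with maximum `f n + 1` has strictly smaller perimeter than one of the identities predicts.
theorem not_identities_of_mem {n : ℕ} (hn : 1152 ≤ n) (hE : n ∈ exceptions) :
    ¬ (P n = f n + Q (g n) ∧ Q n = 1 + f n + P (g n)) := by
  rintro ⟨hP, hQ⟩
  have h := large_exceptions_check n hE
  rw [Bool.or_eq_true, Nat.blt_eq, or_iff_right (by omega)] at h
  obtain ⟨a, ha, h⟩ := of_anyBelow h
  simp only [betterStep, Bool.and_eq_true, Bool.or_eq_true, Nat.blt_eq, Nat.ble_eq] at h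
  obtain ⟨⟨h1, h2⟩, h3⟩ := h
  obtain rfl := f_eq ha h1
  have hfg := f_mul_succ n
  rw [show f n * (f n + 1) / 2 - n = g n by omega] at h2 h3
  rw [← (table_correct _ h2).1, ← (table_correct _ h2).2, ← (table_correct (g n) (by omega)).1,
    ← (table_correct (g n) (by omega)).2] at h3
  have hstep : (f n + 1) * (f n + 1 + 1) = 2 * (n + (g n + f n + 1)) := by nlinarith
  obtain ⟨h3, h4⟩ | ⟨h3, h4⟩ := h3
  · have := P_le_add_Q hstep (by omega)
    omega
  · have := Q_le_add_P hstep (by omega)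
    omega

set_option maxRecDepth 10000 in
theorem theorem6p5 :
    -- `f` is the nearest-integer function of `√(2n)`, and `f n`, `g n` are the smallest
    -- nonnegative integers with `[1 + 2 + ⋯ + f n] - g n = n`
    (∀ n : ℕ, (f n : ℤ) = round √(2 * (n : ℝ)) ∧
      f n * (f n + 1) / 2 = n + g n ∧
      (∑ i ∈ Finset.Icc 1 (f n), (i : ℤ)) - (g n : ℤ) = n ∧
      ∀ a b : ℕ, (∑ i ∈ Finset.Icc 1 a, (i : ℤ)) - (b : ℤ) = n → f n ≤ a ∧ g n ≤ b) ∧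
    -- the exceptions are 177 in number, and they are exactly the `n` at which the pair of
    -- identities does not hold
    exceptions.card = 177 ∧
    (∀ n : ℕ, n ∉ exceptions ↔ (P n = f n + Q (g n) ∧ Q n = 1 + f n + P (g n))) ∧
    -- in particular the identities hold for all `n > 149894`
    (∀ n : ℕ, 149894 < n → P n = f n + Q (g n) ∧ Q n = 1 + f n + P (g n)) := by
  have key : ∀ n : ℕ, n ∉ exceptions ↔ (P n = f n + Q (g n) ∧ Q n = 1 + f n + P (g n)) := by
    intro n
    rcases lt_or_ge n 1152 with hn | hn
    · exact ⟨identities_of_not_mem_of_lt hn, fun h hE => not_identities_of_mem_of_lt hn hE h⟩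
    · exact ⟨identities_of_not_mem hn, fun h hE => not_identities_of_mem hn hE h⟩
  refine ⟨fun n => ⟨f_eq_round n, ?_, ?_, fun a b hab => ?_⟩, by decide +kernel, key,
    fun n hn => (key n).1 fun hE => ?_⟩
  · have := f_mul_succ n
    omega
  · have h1 := two_mul_sum_Icc (f n)
    have h2 : (f n : ℤ) * (f n + 1) = 2 * (n + g n) := by exact_mod_cast f_mul_succ n
    omega
  · have h1 := two_mul_sum_Icc a
    have h2 : (a : ℤ) * (a + 1) = 2 * (n + b) := by omega
    have h3 : a * (a + 1) = 2 * (n + b) := by exact_mod_cast h2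
    have h4 : f n ≤ a := f_le (by omega)
    have h5 := f_mul_succ n
    have h6 : f n * (f n + 1) ≤ a * (a + 1) := Nat.mul_le_mul h4 (by omega)
    exact ⟨h4, by omega⟩
  · have : ∀ n ∈ exceptions, n ≤ 149894 := by decide +kernel
    exact absurd (this n hE) (by omega)
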